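/- Let $\operatorname{erf}(x)=\frac{2}{\sqrt\pi}\int_0^x e^{-t^2}\,dt$. (1) (Central limit theorem.) Let $X_1,X_2,\dots$ be i.i.d. real random variables with mean $\mu$ and finite variance $\sigma^2$, $\sigma>0$, and let $S=\sum_{i=1}^{n}X_i$. Then $\frac{S-n\mu}{\sqrt{n\sigma^2}}$ converges in distribution to $\mathcal N(0,1)$ as $n\to\infty$. Let $0<p<1$, and let $b$ be a random Bloom filter of length $n_l$ whose bits are independent and equal to $1$ with probability $p$ (for instance $p=\tfrac12$); let $n_1$ be its number of set bits. Put $\mu=p$ and $\sigma=\sqrt{p(1-p)}$. A dummy record of $b$ is made by flipping each bit of $b$ independently with probability $flip\in[0,1]$. The Dice coefficient of two Bloom filters is $\frac{2c}{x_1+x_2}$, where $c$ is the number of positions that are set in both and $x_1,x_2$ are their numbers of set bits (it is $0$ if $x_1+x_2=0$). Let $\mathrm{Dice}_{dum}(b)=\frac{2\,\mathbb E[c]}{n_1+\mathbb E[x_2]}$ be the Dice coefficient of $b$ and its dummy record with $c$ and $x_2$ at their expected values over the flips of $b$ (again $0$ if the denominator is $0$). The dummy record is a false match with its progenitor if $\mathrm{Dice}_{dum}>T$,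 and $P(FP)$ is the probability of this event. (2) The bits of $b$ are independent with mean $\mu=p$ and variance $\sigma^2=p(1-p)$, and $n_1$ has the binomial distribution $B(n_l,p)$. (3) For every $b$ and every $flip\in[0,1]$, $\mathbb E[c]=(1-flip)\,n_1$ and $\mathbb E[x_2]=(1-flip)\,n_1+flip\,(n_l-n_1)$, so that $$\mathrm{Dice}_{dum}=\frac{2(1-flip)n_1}{n_1+(1-flip)n_1+flip(n_l-n_1)},$$ and this equals $\left(\frac{flip\,n_l}{2(1-flip)n_1}+1\right)^{-1}$ if $flip<1$ and $n_1>0$. (4) For $0\le T<1$ and $0\le flip<1$, the dummy record is a false match if and only if $n_1>\frac{n_l\,T\,flip}{2(1-T)(1-flip)}$, and hence $$P(FP)=\sum_{\substack{0\le k\le n_l\\ k>\frac{n_l T\,flip}{2(1-T)(1-flip)}}}\binom{n_l}{k}p^k(1-p)^{n_l-k}.$$ (5) Let $$A_{n_l}(T,flip)=\frac12\left[1-\operatorname{erf}\left(\frac{\sqrt{n_l}\,T\,flip}{2\sqrt2\,\sigma(1-T)(1-flip)}-\frac{\sqrt{n_l}\,\mu}{\sigma\sqrt2}\right)\right].$$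 For fixed $p$, $P(FP)-A_{n_l}(T,flip)\to0$ as $n_l\to\infty$, uniformly in $0\le T<1$ and $0\le flip<1$. (6) For each fixed $0\le T<1$ and $0\le flip<1$, the probability that the Dice coefficient of $b$ and the dummy record actually produced by the random flips (with the flips independent of $b$) exceeds $T$ also differs from $A_{n_l}(T,flip)$ by a quantity that tends to $0$ as $n_l\to\infty$. -/

import Mathlib

open MeasureTheory ProbabilityTheory Filter Topology Finset

namespace BloomLinkage

noncomputable section

/-- The error function `erf x = (2 / √π) ∫₀ˣ exp (-t²) dt`. -/
def erf (x : ℝ) : ℝ := 2 / √Real.pi * ∫ t in (0 : ℝ)..x, Real.exp (-t ^ 2)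

/-- A Bloom filter with `n` bits. -/
abbrev BloomFilter (n : ℕ) : Type := Fin n → Bool

/-- The numerical value (`0` or `1`) of a bit. -/
def bitVal (x : Bool) : ℝ := if x = true then 1 else 0

/-- The number of bit positions of `b` that are set to `1`. -/
def numOnes {n : ℕ} (b : BloomFilter n) : ℕ := #{i | b i = true}

/-- The number of bit positions that are set to `1` in both `b` and `b'`. -/
def numCommon {n : ℕ} (b b' : BloomFilter n) : ℕ := #{i | b i = true ∧ b' i = true}

/-- The Dice coefficient `2c / (x₁ + x₂)` of two Bloom filters
(with the value `0` if neither filter has a set bit). -/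
def dice {n : ℕ} (b b' : BloomFilter n) : ℝ :=
  2 * (numCommon b b' : ℝ) / ((numOnes b : ℝ) + (numOnes b' : ℝ))

/-- The law of `n` independent bits, each of which is `1` with probability `q`. -/
def bitsLaw (n : ℕ) (q : unitInterval) : Measure (BloomFilter n) :=
  Measure.pi fun _ => bernoulliMeasure true false q

/-- The dummy record made from the progenitor `b` by flipping exactly the bits
that are marked in `φ`. -/
def dummy {n : ℕ} (b φ : BloomFilter n) : BloomFilter n := fun i => xor (b i) (φ i)

/-- The expected number of common set bits of `b` and its dummy record, when each bit is
flipped independently with probability `f`. -/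
def expCommon {n : ℕ} (f : unitInterval) (b : BloomFilter n) : ℝ :=
  ∫ φ, (numCommon b (dummy b φ) : ℝ) ∂(bitsLaw n f)

/-- The expected number of set bits of the dummy record of `b`, when each bit is
flipped independently with probability `f`. -/
def expOnes {n : ℕ} (f : unitInterval) (b : BloomFilter n) : ℝ :=
  ∫ φ, (numOnes (dummy b φ) : ℝ) ∂(bitsLaw n f)

/-- The Dice coefficient `2c / (x₁ + x₂)` of the progenitor `b` and its dummy record, with
the number `c` of common set bits and the number `x₂` of set bits of the dummy record taken
at their expected values over the random flips. -/
def diceDum {n : ℕ} (f : unitInterval) (b : BloomFilter n) : ℝ :=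
  2 * expCommon f b / ((numOnes b : ℝ) + expOnes f b)

/-- The number of set bits that the progenitor has to exceed,
`n T f / (2 (1 - T) (1 - f))`. -/
def onesThreshold (n : ℕ) (T : ℝ) (f : unitInterval) : ℝ :=
  n * T * f / (2 * (1 - T) * (1 - f))

/-- The probability of a false match `diceDum > T` of a dummy record with its progenitor, for
a progenitor with independent bits that are set with probability `p`. -/
def probFP (n : ℕ) (p : unitInterval) (T : ℝ) (f : unitInterval) : ℝ :=
  (bitsLaw n p).real {b | T < diceDum f b}

/-- The probability that the Dice coefficient of a random progenitor and the dummy record that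
really results from random independent flips exceeds `T`. -/
def probFPFlips (n : ℕ) (p : unitInterval) (T : ℝ) (f : unitInterval) : ℝ :=
  ((bitsLaw n p).prod (bitsLaw n f)).real {x | T < dice x.1 (dummy x.1 x.2)}

/-- The closed-form approximation of the probability of a false match. -/
def approxFP (n : ℕ) (T : ℝ) (f : unitInterval) (μ σ : ℝ) : ℝ :=
  1 / 2 * (1 - erf (√n * T * f / (2 * √2 * σ * (1 - T) * (1 - f)) - √n * μ / (σ * √2)))

end

end BloomLinkage

namespace BloomLinkage

/-! ### The normal tail function and the error function -/

/-! With `c` and `x₂` at their expectations, the inequality `T < diceDum f b` becomes linear in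
`numOnes b` once the denominator is cleared, so a false match is the event that a sum of i.i.d. bits
exceeds `onesThreshold`. The central limit theorem gives the normal tail at the standardized
threshold, which is `approxFP`. Since `T` and `f` enter only through the threshold, uniformity in
them follows from uniformity in the point at which the tail is taken; this is Pólya's theorem, the
limit being continuous.

With real flips, `T < dice` says that `2c - T (x₁ + x₂)`, a sum over positions of i.i.d. terms
`excess`, is positive. Its mean per position is `m = 2 (1 - T) (1 - f) p - T f`, but its variance
`v` is not the one built into `approxFP`. The two tails are taken at `-√n m / √v` and at another
positive multiple of `-√n m`: both tend to `0` or both to `1` if `m ≠ 0`, and they coincide if `m =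
0`. This argument is for fixed `T` and `f`. -/

/-- The upper tail `x ↦ P(Z > x)` of a standard normal variable `Z`. -/
noncomputable def gaussianTail (x : ℝ) : ℝ := (gaussianReal 0 1).real (Set.Ioi x)

lemma gaussianTail_eq_one_sub_cdf (x : ℝ) : gaussianTail x = 1 - cdf (gaussianReal 0 1) x := by
  rw [gaussianTail, cdf_eq_real, ← Set.compl_Iic, probReal_compl_eq_one_sub measurableSet_Iic]

/-- The tail is the half mass on `(0, ∞)` minus the integral of the density over `0..x`, which the
substitution `t = √2 u` turns into `erf`. -/
lemma gaussianTail_eq_erf (x : ℝ) : gaussianTail x = 1 / 2 * (1 - erf (x / √2)) := by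
  have hpdf : ∀ t, gaussianPDFReal 0 1 t = (√(2 * Real.pi))⁻¹ * Real.exp (-(1 / 2) * t ^ 2) := by
    intro t
    simp only [gaussianPDFReal, NNReal.coe_one, mul_one, sub_zero]
    congr 2
    ring
  have hint : Integrable (gaussianPDFReal 0 1) := integrable_gaussianPDFReal 0 1
  have htail : gaussianTail x = ∫ t in Set.Ioi x, gaussianPDFReal 0 1 t := by
    rw [gaussianTail, measureReal_def, gaussianReal_apply_eq_integral _ one_ne_zero,
      ENNReal.toReal_ofReal]
    exact integral_nonneg fun t => gaussianPDFReal_nonneg _ _ _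
  have hsplit := intervalIntegral.integral_interval_add_Ioi
    (hint.integrableOn (s := Set.Ioi 0)) (hint.integrableOn (s := Set.Ioi x))
  have hhalf : ∫ t in Set.Ioi (0 : ℝ), gaussianPDFReal 0 1 t = 1 / 2 := by
    simp_rw [hpdf]
    rw [integral_const_mul, integral_gaussian_Ioi,
      show Real.pi / (1 / 2) = 2 * Real.pi by ring]
    have : √(2 * Real.pi) ≠ 0 := by positivity
    field_simp
  have hint0 : ∫ t in (0 : ℝ)..x, gaussianPDFReal 0 1 t = 1 / 2 * erf (x / √2) := by
    have h2 : √2 ≠ 0 := by positivity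
    have hexp : ∀ t : ℝ, Real.exp (-(1 / 2) * t ^ 2) = Real.exp (-(t / √2) ^ 2) := by
      intro t
      congr 1
      rw [div_pow, Real.sq_sqrt zero_le_two]
      ring
    simp_rw [hpdf, hexp]
    rw [intervalIntegral.integral_const_mul,
      intervalIntegral.integral_comp_div (fun u => Real.exp (-u ^ 2)) h2, erf, zero_div,
      Real.sqrt_mul zero_le_two, smul_eq_mul]
    have : √Real.pi ≠ 0 := by positivity
    field_simp
  rw [htail]
  linarith

lemma continuous_gaussianTail : Continuous gaussianTail := by
  have : Continuous erf := by
    refine continuous_const.mul (intervalIntegral.continuous_primitive (fun a b => ?_) 0)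
    exact Continuous.intervalIntegrable (by fun_prop) _ _
  simp_rw [funext gaussianTail_eq_erf]
  fun_prop

lemma tendsto_gaussianTail_atBot : Tendsto gaussianTail atBot (𝓝 1) := by
  simpa [funext gaussianTail_eq_one_sub_cdf] using
    (tendsto_cdf_atBot (gaussianReal 0 1)).const_sub 1

lemma tendsto_gaussianTail_atTop : Tendsto gaussianTail atTop (𝓝 0) := by
  simpa [funext gaussianTail_eq_one_sub_cdf] using
    (tendsto_cdf_atTop (gaussianReal 0 1)).const_sub 1

/-! ### Uniform convergence of distribution functions -/

/-- **Pólya's theorem**: antitone functions with values in `[0, 1]` that converge pointwise to a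
continuous antitone function with limits `1` at `-∞` and `0` at `∞` converge uniformly. -/
lemma tendstoUniformly_of_antitone {ι : Type*} {l : Filter ι} {G : ι → ℝ → ℝ} {F : ℝ → ℝ}
    (hG : ∀ i, Antitone (G i)) (hG0 : ∀ i x, 0 ≤ G i x) (hG1 : ∀ i x, G i x ≤ 1)
    (hF : Antitone F) (hFc : Continuous F) (hFbot : Tendsto F atBot (𝓝 1))
    (hFtop : Tendsto F atTop (𝓝 0)) (hlim : ∀ x, Tendsto (fun i => G i x) l (𝓝 (F x))) :
    TendstoUniformly G F l := by
  have hF0 : ∀ x, 0 ≤ F x := fun x => hF.le_of_tendsto hFtop x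
  have hF1 : ∀ x, F x ≤ 1 := fun x => hF.ge_of_tendsto hFbot x
  have hsurj : ∀ c : ℝ, 0 < c → c < 1 → ∃ y, F y = c := fun c hc0 hc1 => by
    obtain ⟨a, ha⟩ := (hFtop.eventually_lt_const hc0).exists
    obtain ⟨b, hb⟩ := (hFbot.eventually_const_lt hc1).exists
    exact mem_range_of_exists_le_of_exists_ge hFc ⟨a, ha.le⟩ ⟨b, hb.le⟩
  -- One point suffices for each level `c`: if `F y = c`, every `x` with `c < F x` lies to the left
  -- of `y`, so `G i x ≥ G i y > c - δ`. Levels outside `(0, 1)` are trivial.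
  have hlow : ∀ c δ : ℝ, 0 < δ → ∀ᶠ i in l, ∀ x, c < F x → c - δ < G i x := by
    intro c δ hδ
    rcases le_or_gt c 0 with hc | hc
    · exact .of_forall fun i x _ => by linarith [hG0 i x]
    rcases le_or_gt 1 c with hc1 | hc1
    · exact .of_forall fun i x hx => by linarith [hF1 x]
    obtain ⟨y, hy⟩ := hsurj c hc hc1
    filter_upwards [(hlim y).eventually_const_lt (u := c - δ) (by linarith)] with i hi x hx
    have hxy : x ≤ y := by
      by_contra! h
      linarith [hF h.le]
    exact hi.trans_le (hG i hxy)
  have hupp : ∀ c δ : ℝ, 0 < δ → ∀ᶠ i in l, ∀ x, F x < c → G i x < c + δ := by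
    intro c δ hδ
    rcases le_or_gt 1 c with hc1 | hc1
    · exact .of_forall fun i x _ => by linarith [hG1 i x]
    rcases le_or_gt c 0 with hc | hc
    · exact .of_forall fun i x hx => by linarith [hF0 x]
    obtain ⟨y, hy⟩ := hsurj c hc hc1
    filter_upwards [(hlim y).eventually_lt_const (u := c + δ) (by linarith)] with i hi x hx
    have hxy : y ≤ x := by
      by_contra! h
      linarith [hF h.le]
    exact (hG i hxy).trans_lt hi
  rw [Metric.tendstoUniformly_iff]
  intro ε hε
  set δ := ε / 3 with hδ
  have hδ0 : 0 < δ := by positivity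
  -- Only finitely many levels `j δ` are needed. With `j = ⌊F x / δ⌋₊`, the lower level is `(j - 1)
  -- δ` because `F x = j δ` is possible and `hlow` needs a strict inequality; the worst gap is then
  -- `3 δ = ε`.
  have hall : ∀ᶠ i in l, ∀ j ∈ range (⌊1 / δ⌋₊ + 1),
      (∀ x, (j - 1) * δ < F x → (j - 1) * δ - δ < G i x) ∧
      (∀ x, F x < (j + 1) * δ → G i x < (j + 1) * δ + δ) :=
    (eventually_all_finset _).2 fun j _ => (hlow _ δ hδ0).and (hupp _ δ hδ0)
  filter_upwards [hall] with i hi x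
  have hj : ⌊F x / δ⌋₊ ∈ range (⌊1 / δ⌋₊ + 1) := by
    rw [mem_range, Nat.lt_succ_iff]
    gcongr
    exact hF1 x
  obtain ⟨h1, h2⟩ := hi _ hj
  have h3 : (⌊F x / δ⌋₊ : ℝ) * δ ≤ F x :=
    (le_div_iff₀ hδ0).1 (Nat.floor_le (div_nonneg (hF0 x) hδ0.le))
  have h4 : F x < (⌊F x / δ⌋₊ + 1) * δ := (div_lt_iff₀ hδ0).1 (Nat.lt_floor_add_one _)
  have h5 := h1 x (by linarith)
  have h6 := h2 x h4
  rw [Real.dist_eq, abs_lt]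
  constructor <;> linarith

/-! ### The central limit theorem -/

section CentralLimit

variable {Ω : Type*} [MeasurableSpace Ω] {P : Measure Ω} [IsProbabilityMeasure P]
  {X : ℕ → Ω → ℝ} {μ σ : ℝ}

/-- The central limit theorem for the standardized sums `(∑ Xᵢ - n μ) / √(n σ²)`. -/
theorem tendstoInDistribution_standardized_sum (hindep : iIndepFun X P)
    (hident : ∀ i, IdentDistrib (X i) (X 0) P P) (hX : MemLp (X 0) 2 P)
    (hμ : ∫ ω, X 0 ω ∂P = μ) (hσ : 0 < σ) (hVar : variance (X 0) P = σ ^ 2) :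
    TendstoInDistribution
      (fun (n : ℕ) ω => ((∑ i ∈ range n, X i ω) - n * μ) / √(n * σ ^ 2)) atTop
      (fun x : ℝ => x) (fun _ => P) (gaussianReal 0 1) := by
  have mX0 := (hident 0).aemeasurable_fst
  have hY : HasLaw (fun x : ℝ => x) (gaussianReal 0 1) (gaussianReal 0 1) :=
    ⟨by fun_prop, Measure.map_id⟩
  have hfun : (fun (n : ℕ) ω => ((∑ i ∈ range n, X i ω) - n * μ) / √(n * σ ^ 2)) =
      fun (n : ℕ) ω => (√n)⁻¹ * ∑ k ∈ range n, (X k ω - μ) / σ := by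
    ext n ω
    rw [← Finset.sum_div, Finset.sum_sub_distrib, Real.sqrt_mul n.cast_nonneg,
      Real.sqrt_sq hσ.le]
    simp [field]
  rw [hfun]
  refine tendstoInDistribution_inv_sqrt_mul_sum hY ?_ ?_ ?_ fun n => ?_
  · rw [integral_div, integral_sub (hX.integrable (by norm_num)) (by simp), hμ]
    simp
  · simp only [Pi.pow_apply, div_pow]
    rw [integral_div, ← hμ, ← variance_eq_integral mX0, hVar, div_self (by positivity)]
  · exact hindep.comp (fun _ x => (x - μ) / σ) (by fun_prop)
  · exact (hident n).comp (u := fun x => (x - μ) / σ) (by fun_prop)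

/-- The tails of standardized sums converge uniformly to the normal tail. -/
theorem tendstoUniformly_tail_standardized_sum (hindep : iIndepFun X P)
    (hident : ∀ i, IdentDistrib (X i) (X 0) P P) (hX : MemLp (X 0) 2 P)
    (hμ : ∫ ω, X 0 ω ∂P = μ) (hσ : 0 < σ) (hVar : variance (X 0) P = σ ^ 2) :
    TendstoUniformly (fun (n : ℕ) (x : ℝ) =>
      P.real {ω | x < ((∑ i ∈ range n, X i ω) - n * μ) / √(n * σ ^ 2)}) gaussianTail atTop := by
  refine tendstoUniformly_of_antitone (fun n x y hxy => ?_) (fun _ _ => measureReal_nonneg)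
    (fun _ _ => measureReal_le_one) (fun x y hxy => ?_) continuous_gaussianTail
    tendsto_gaussianTail_atBot tendsto_gaussianTail_atTop fun x => ?_
  · exact measureReal_mono fun ω hω => hxy.trans_lt hω
  · exact measureReal_mono (Set.Ioi_subset_Ioi hxy)
  · have h := tendstoInDistribution_standardized_sum hindep hident hX hμ hσ hVar
    -- The frontier `{x}` of `Ioi x` is null, so weak convergence gives convergence of the tail at
    -- every `x`.
    have : NullSingletonClass (gaussianReal 0 1) := nullSingletonClass_gaussianReal one_ne_zero
    have hlim := ProbabilityMeasure.tendsto_measure_of_null_frontier_of_tendsto' h.tendsto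
      (E := Set.Ioi x) (by simp)
    simp only [ProbabilityMeasure.coe_mk, Measure.map_id'] at hlim
    convert! (ENNReal.tendsto_toReal (measure_ne_top _ _)).comp hlim using 2 with n
    simp only [Function.comp_apply]
    rw [Measure.map_apply_of_aemeasurable (h.forall_aemeasurable n) measurableSet_Ioi]
    rfl

end CentralLimit

/-- Uniform normal approximation for sums of a function of i.i.d. coordinates: the probability
that such a sum exceeds `x` is close to a normal tail, uniformly in `x`. -/
theorem pi_sum_tail_approx {α : Type*} [MeasurableSpace α] (ν : Measure α)
    [IsProbabilityMeasure ν] {g : α → ℝ} (hg : Measurable g) (hg2 : MemLp g 2 ν) {μ σ : ℝ}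
    (hμ : ∫ a, g a ∂ν = μ) (hσ : 0 < σ) (hVar : variance g ν = σ ^ 2) {ε : ℝ} (hε : 0 < ε) :
    ∀ᶠ n : ℕ in atTop, ∀ x : ℝ,
      |(Measure.pi fun _ : Fin n => ν).real {a | x < ∑ i, g (a i)} -
        gaussianTail ((x - n * μ) / √(n * σ ^ 2))| < ε := by
  -- The central limit theorem needs one sequence on one space; the first `n` coordinates of the
  -- infinite product have the law in the statement.
  let P : Measure (ℕ → α) := Measure.infinitePi fun _ => ν
  have hmap : ∀ i, P.map (fun ω : ℕ → α => ω i) = ν := Measure.infinitePi_map_eval _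
  have hmeas : ∀ i, Measurable fun ω : ℕ → α => ω i := measurable_pi_apply
  have hind : iIndepFun (fun (i : ℕ) (ω : ℕ → α) => g (ω i)) P :=
    iIndepFun_infinitePi (X := fun _ => g) fun _ => hg
  have hident : ∀ i, IdentDistrib (fun ω : ℕ → α => g (ω i)) (fun ω => g (ω 0)) P P := fun i =>
    IdentDistrib.comp (⟨(hmeas i).aemeasurable, (hmeas 0).aemeasurable,
      (hmap i).trans (hmap 0).symm⟩ : IdentDistrib (fun ω : ℕ → α => ω i) (fun ω => ω 0) P P) hg
  have hmp : MeasurePreserving (fun ω : ℕ → α => ω 0) P ν := ⟨hmeas 0, hmap 0⟩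
  have hunif := tendstoUniformly_tail_standardized_sum hind hident (hg2.comp_measurePreserving hmp)
    (μ := μ) (by rw [← hμ, ← hmap 0, integral_map (hmeas 0).aemeasurable]
                 exact hg.aestronglyMeasurable) hσ
    (by rw [← hVar, ← hmap 0, variance_map hg.aemeasurable (hmeas 0).aemeasurable]; rfl)
  filter_upwards [Metric.tendstoUniformly_iff.1 hunif ε hε, eventually_gt_atTop 0] with n hn hn0 x
  have hfin : P.map (fun ω (i : Fin n) => ω i) = Measure.pi fun _ : Fin n => ν := by
    have := (iIndepFun_infinitePi (P := fun _ : ℕ => ν) (X := fun _ => id)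
      fun _ => measurable_id).precomp (Fin.val_injective (n := n))
    have := (iIndepFun_iff_map_fun_eq_pi_map
      fun i : Fin n => (hmeas i).aemeasurable).1 this
    rw [show P.map (fun ω (i : Fin n) => ω i) = _ from this]
    exact congrArg Measure.pi (funext fun i : Fin n => hmap i)
  have hset : MeasurableSet {a : Fin n → α | x < ∑ i, g (a i)} :=
    measurableSet_lt measurable_const (by fun_prop)
  have hpos : 0 < √(n * σ ^ 2) := by positivity
  specialize hn ((x - n * μ) / √(n * σ ^ 2))
  rw [dist_comm, Real.dist_eq] at hn
  rw [← hfin, map_measureReal_apply (by fun_prop) hset]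
  convert hn using 4
  ext ω
  simp only [Set.mem_preimage, Set.mem_ofPred_eq]
  rw [div_lt_div_iff_of_pos_right hpos, sub_lt_sub_iff_right,
    Fin.sum_univ_eq_sum_range (fun i => g (ω i)) n]

/-! ### Bits and their laws -/

@[simp] lemma bitVal_true : bitVal true = 1 := rfl

@[simp] lemma bitVal_false : bitVal false = 0 := rfl

lemma numOnes_eq_sum {n : ℕ} (b : BloomFilter n) : (numOnes b : ℝ) = ∑ i, bitVal (b i) := by
  simp [numOnes, bitVal]

lemma numOnes_le {n : ℕ} (b : BloomFilter n) : numOnes b ≤ n := by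
  simpa [numOnes] using card_filter_le (univ : Finset (Fin n)) fun i => b i = true

lemma numCommon_dummy_eq_sum {n : ℕ} (b φ : BloomFilter n) :
    (numCommon b (dummy b φ) : ℝ) = ∑ i, bitVal (b i) * (1 - bitVal (φ i)) := by
  rw [numCommon, ← sum_boole]
  refine sum_congr rfl fun i _ => ?_
  cases hb : b i <;> cases hφ : φ i <;> simp [dummy, hb, hφ]

lemma numOnes_dummy_eq_sum {n : ℕ} (b φ : BloomFilter n) :
    (numOnes (dummy b φ) : ℝ) =
      ∑ i, (bitVal (b i) * (1 - bitVal (φ i)) + (1 - bitVal (b i)) * bitVal (φ i)) := by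
  rw [numOnes_eq_sum]
  refine sum_congr rfl fun i _ => ?_
  cases hb : b i <;> cases hφ : φ i <;> simp [dummy, hb, hφ]

lemma integral_bitVal (q : unitInterval) :
    ∫ x, bitVal x ∂(bernoulliMeasure true false q) = q := by
  simp [integral_bernoulliMeasure]

lemma variance_bitVal (q : unitInterval) :
    variance bitVal (bernoulliMeasure true false q) = q * (1 - q) := by
  rw [variance_eq_sub MemLp.of_discrete, integral_bitVal]
  simp [integral_bernoulliMeasure]
  ring

instance (n : ℕ) (q : unitInterval) : IsProbabilityMeasure (bitsLaw n q) := by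
  unfold bitsLaw
  infer_instance

lemma measurePreserving_eval_bitsLaw {n : ℕ} (q : unitInterval) (i : Fin n) :
    MeasurePreserving (fun b : BloomFilter n => b i) (bitsLaw n q)
      (bernoulliMeasure true false q) :=
  measurePreserving_eval (fun _ : Fin n => bernoulliMeasure true false q) i

lemma iIndepFun_bitVal (n : ℕ) (q : unitInterval) :
    iIndepFun (fun (i : Fin n) (b : BloomFilter n) => bitVal (b i)) (bitsLaw n q) :=
  iIndepFun_pi (X := fun _ => bitVal) fun _ => (measurable_of_finite _).aemeasurable

lemma integral_bit {n : ℕ} (q : unitInterval) (i : Fin n) (g : Bool → ℝ) :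
    ∫ b, g (b i) ∂(bitsLaw n q) = q * g true + (1 - q) * g false := by
  have h := measurePreserving_eval_bitsLaw q i
  rw [← integral_map (f := g) h.measurable.aemeasurable
    (measurable_of_finite g).aestronglyMeasurable, h.map_eq]
  simp [integral_bernoulliMeasure]

lemma variance_bit {n : ℕ} (q : unitInterval) (i : Fin n) :
    variance (fun b : BloomFilter n => bitVal (b i)) (bitsLaw n q) = q * (1 - q) := by
  have h := measurePreserving_eval_bitsLaw q i
  rw [← variance_bitVal, ← h.map_eq,
    variance_map (measurable_of_finite _).aemeasurable h.measurable.aemeasurable]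
  rfl

lemma integral_sum_bits {n : ℕ} (q : unitInterval) (g : Fin n → Bool → ℝ) :
    ∫ b, ∑ i, g i (b i) ∂(bitsLaw n q) = ∑ i, (q * g i true + (1 - q) * g i false) := by
  rw [integral_finsetSum _ fun i _ => Integrable.of_finite]
  exact sum_congr rfl fun i _ => integral_bit q i (g i)

lemma bitsLaw_real_singleton {n : ℕ} (q : unitInterval) (b : BloomFilter n) :
    (bitsLaw n q).real {b} = (q : ℝ) ^ numOnes b * (1 - q) ^ (n - numOnes b) := by
  have hbit : ∀ i, (bernoulliMeasure true false q).real {b i} =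
      if b i = true then (q : ℝ) else 1 - q := by
    intro i
    cases b i <;> simp
  rw [bitsLaw, measureReal_def, Measure.pi_singleton, ENNReal.toReal_prod]
  simp_rw [← measureReal_def, hbit]
  rw [prod_ite, prod_const, prod_const, numOnes]
  congr 2
  have := card_filter_add_card_filter_not (s := (univ : Finset (Fin n))) fun i => b i = true
  rw [card_univ, Fintype.card_fin] at this
  omega

lemma card_numOnes_eq (n k : ℕ) : #{b : BloomFilter n | numOnes b = k} = n.choose k := by
  have h : #(powersetCard k (univ : Finset (Fin n))) = n.choose k := by
    simp
  rw [← h]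
  refine card_bij' (fun b _ => univ.filter fun i => b i = true) (fun s _ i => decide (i ∈ s)) ?_ ?_ ?_ ?_
  · intro b hb
    exact mem_powersetCard.2 ⟨subset_univ _, (mem_filter.1 hb).2⟩
  · intro s hs
    refine mem_filter.2 ⟨mem_univ _, ?_⟩
    simpa [numOnes] using (mem_powersetCard.1 hs).2
  · intro b _
    ext i
    simp
  · intro s _
    ext i
    simp

lemma bitsLaw_real_numOnes_eq (n k : ℕ) (q : unitInterval) :
    (bitsLaw n q).real {b | numOnes b = k} = n.choose k * (q : ℝ) ^ k * (1 - q) ^ (n - k) := by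
  have hset : {b : BloomFilter n | numOnes b = k} =
      ↑({b | numOnes b = k} : Finset (BloomFilter n)) := by simp
  rw [hset, ← sum_measureReal_singleton,
    sum_congr rfl (g := fun _ => (q : ℝ) ^ k * (1 - q) ^ (n - k)) fun b hb => by
      rw [bitsLaw_real_singleton, (mem_filter.1 hb).2], sum_const, card_numOnes_eq, nsmul_eq_mul,
    mul_assoc]

lemma map_numOnes_bitsLaw (n : ℕ) (q : unitInterval) :
    (bitsLaw n q).map numOnes = ProbabilityTheory.binomial n q := by
  have : IsProbabilityMeasure ((bitsLaw n q).map (numOnes (n := n))) :=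
    Measure.isProbabilityMeasure_map (measurable_of_finite _).aemeasurable
  refine Measure.ext_of_measureReal_singleton fun k => ?_
  rw [binomial_real_singleton, map_measureReal_apply (measurable_of_finite _) (by simp),
    ← bitsLaw_real_numOnes_eq]
  rfl

/-! ### The Dice coefficient of a dummy record -/

lemma expCommon_eq {n : ℕ} (f : unitInterval) (b : BloomFilter n) :
    expCommon f b = (1 - f) * numOnes b := by
  simp_rw [expCommon, numCommon_dummy_eq_sum]
  rw [integral_sum_bits f fun i x => bitVal (b i) * (1 - bitVal x), numOnes_eq_sum, mul_sum]
  exact sum_congr rfl fun i _ => by simp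

lemma expOnes_eq {n : ℕ} (f : unitInterval) (b : BloomFilter n) :
    expOnes f b = (1 - f) * numOnes b + f * (n - numOnes b) := by
  simp_rw [expOnes, numOnes_dummy_eq_sum]
  rw [integral_sum_bits f
    fun i x => bitVal (b i) * (1 - bitVal x) + (1 - bitVal (b i)) * bitVal x, numOnes_eq_sum]
  have hn : (n : ℝ) = ∑ _i : Fin n, 1 := by simp
  rw [hn, ← sum_sub_distrib, mul_sum, mul_sum, ← sum_add_distrib]
  refine sum_congr rfl fun i _ => ?_
  simp
  ring

lemma diceDum_eq {n : ℕ} (f : unitInterval) (b : BloomFilter n) :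
    diceDum f b = 2 * (1 - f) * numOnes b /
      (numOnes b + (1 - f) * numOnes b + f * (n - numOnes b)) := by
  rw [diceDum, expCommon_eq, expOnes_eq, mul_assoc, add_assoc]

lemma diceDum_eq_inv {n : ℕ} {f : unitInterval} {b : BloomFilter n} (hf : (f : ℝ) < 1)
    (hb : 0 < numOnes b) :
    diceDum f b = ((f : ℝ) * n / (2 * (1 - f) * numOnes b) + 1)⁻¹ := by
  have h1 : 0 < 1 - (f : ℝ) := by linarith
  have h2 : (0 : ℝ) < numOnes b := by exact_mod_cast hb
  have h3 : (0 : ℝ) ≤ f * n := mul_nonneg f.2.1 n.cast_nonneg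
  have h4 : 0 < 2 * (1 - (f : ℝ)) * numOnes b := by positivity
  rw [diceDum_eq, div_add_one h4.ne', inv_div]
  congr 1
  ring

lemma lt_diceDum_iff {n : ℕ} {T : ℝ} {f : unitInterval} (hT0 : 0 ≤ T) (hT1 : T < 1)
    (hf : (f : ℝ) < 1) (b : BloomFilter n) :
    T < diceDum f b ↔ onesThreshold n T f < numOnes b := by
  have hT : 0 < 1 - T := by linarith
  have h1 : 0 < 1 - (f : ℝ) := by linarith
  have h3 : (0 : ℝ) ≤ f * n := mul_nonneg f.2.1 n.cast_nonneg
  have hden : 0 < 2 * (1 - T) * (1 - (f : ℝ)) := by positivity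
  -- Without set bits the coefficient is `0`, even if the denominator vanishes, and the threshold is
  -- nonnegative: both sides fail.
  rcases (numOnes b).eq_zero_or_pos with hb | hb
  · have h5 : 0 ≤ onesThreshold n T f :=
      div_nonneg (mul_nonneg (mul_nonneg n.cast_nonneg hT0) f.2.1) hden.le
    rw [diceDum_eq, hb]
    simp [hT0.not_gt, h5.not_gt]
  · have h2 : (0 : ℝ) < numOnes b := by exact_mod_cast hb
    have h6 : 0 < 2 * (1 - (f : ℝ)) * numOnes b := by positivity
    rw [diceDum_eq, onesThreshold, div_lt_iff₀ hden, lt_div_iff₀ (by linarith)]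
    constructor <;> intro h <;> linarith

lemma probFP_eq_real_numOnes {n : ℕ} (p : unitInterval) {T : ℝ} {f : unitInterval} (hT0 : 0 ≤ T)
    (hT1 : T < 1) (hf : (f : ℝ) < 1) :
    probFP n p T f = (bitsLaw n p).real {b | onesThreshold n T f < numOnes b} := by
  simp_rw [probFP, lt_diceDum_iff hT0 hT1 hf]

lemma bitsLaw_real_lt_numOnes (n : ℕ) (p : unitInterval) (x : ℝ) :
    (bitsLaw n p).real {b | x < numOnes b} =
      ∑ k ∈ range (n + 1) with x < ((k : ℕ) : ℝ),
        (n.choose k : ℝ) * (p : ℝ) ^ k * (1 - p) ^ (n - k) := by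
  have hset : {b : BloomFilter n | x < numOnes b} =
      ⋃ k ∈ (range (n + 1)).filter fun k : ℕ => x < k, {b | numOnes b = k} := by
    ext b
    simp [numOnes_le]
  rw [hset, measureReal_biUnion_finset]
  · exact sum_congr rfl fun k _ => bitsLaw_real_numOnes_eq n k p
  · intro j _ k _ hjk
    exact Set.disjoint_left.2 fun b hj hk => hjk (hj.symm.trans hk)
  · exact fun k _ => Set.Finite.measurableSet (Set.toFinite _)

/-! ### Normal approximation of the false match probabilities -/

lemma approxFP_eq_gaussianTail (n : ℕ) (T : ℝ) (f : unitInterval) (μ : ℝ) (σ : ℝ) :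
    approxFP n T f μ σ = gaussianTail (√n * (T * f / (2 * (1 - T) * (1 - f)) - μ) / σ) := by
  rw [approxFP, gaussianTail_eq_erf]
  congr 3
  simp only [div_eq_mul_inv, mul_inv]
  ring

lemma sqrt_standardize (n : ℕ) (y : ℝ) {σ : ℝ} (hσ : 0 < σ) :
    n * y / √(n * σ ^ 2) = √n * y / σ := by
  rw [Real.sqrt_mul n.cast_nonneg, Real.sqrt_sq hσ.le]
  rcases n.eq_zero_or_pos with rfl | hn
  · simp
  · have : √(n : ℝ) ≠ 0 := by positivity
    field_simp
    rw [Real.sq_sqrt n.cast_nonneg, mul_comm]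

/-- `pi_sum_tail_approx` holds for all `x` at once, so its `N` serves for every threshold
`onesThreshold n T f`. -/
theorem probFP_approx (p : unitInterval) (hp0 : 0 < (p : ℝ)) (hp1 : (p : ℝ) < 1) {ε : ℝ}
    (hε : 0 < ε) :
    ∃ N : ℕ, ∀ n : ℕ, N ≤ n → ∀ (T : ℝ) (f : unitInterval), 0 ≤ T → T < 1 → (f : ℝ) < 1 →
      |probFP n p T f - approxFP n T f p √(p * (1 - p))| < ε := by
  have hv : 0 < (p : ℝ) * (1 - p) := mul_pos hp0 (by linarith)
  obtain ⟨N, hN⟩ := eventually_atTop.1 (pi_sum_tail_approx (bernoulliMeasure true false p)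
    (measurable_of_finite bitVal) MemLp.of_discrete (integral_bitVal p) (Real.sqrt_pos.2 hv)
    (by rw [variance_bitVal, Real.sq_sqrt hv.le]) hε)
  refine ⟨N, fun n hn T f hT0 hT1 hf => ?_⟩
  have h := hN n hn (onesThreshold n T f)
  rw [show onesThreshold n T f - n * p = n * (T * f / (2 * (1 - T) * (1 - f)) - p) by
      rw [onesThreshold]; ring,
    sqrt_standardize _ _ (Real.sqrt_pos.2 hv)] at h
  rw [approxFP_eq_gaussianTail, probFP_eq_real_numOnes p hT0 hT1 hf]
  simp_rw [numOnes_eq_sum]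
  exact h

/-- The contribution of one bit `x.1`, flipped if `x.2` is set, to `2c - T (x₁ + x₂)`. -/
noncomputable def excess (T : ℝ) (x : Bool × Bool) : ℝ :=
  2 * (bitVal x.1 * (1 - bitVal x.2)) -
    T * (bitVal x.1 + (bitVal x.1 * (1 - bitVal x.2) + (1 - bitVal x.1) * bitVal x.2))

lemma lt_dice_dummy_iff {n : ℕ} {T : ℝ} (hT0 : 0 ≤ T) (b φ : BloomFilter n) :
    T < dice b (dummy b φ) ↔ 0 < ∑ i, excess T (b i, φ i) := by
  have hsum : ∑ i, excess T (b i, φ i) = 2 * (numCommon b (dummy b φ) : ℝ) -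
      T * (numOnes b + numOnes (dummy b φ)) := by
    rw [numCommon_dummy_eq_sum, numOnes_eq_sum b, numOnes_dummy_eq_sum, ← sum_add_distrib,
      mul_sum, mul_sum, ← sum_sub_distrib]
    rfl
  rw [hsum, dice, sub_pos]
  have h0 : (0 : ℝ) ≤ numOnes b + numOnes (dummy b φ) := by positivity
  -- If neither filter has a set bit, `dice` is `0` by the division convention, and `0 ≤ T` makes
  -- both sides false.
  rcases h0.eq_or_lt with h | h
  · have hc : numCommon b (dummy b φ) ≤ numOnes b :=
      card_le_card fun i hi => by
        simp only [mem_filter] at hi ⊢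
        exact ⟨hi.1, hi.2.1⟩
    have hb : numOnes b = 0 := by
      have : numOnes b + numOnes (dummy b φ) = 0 := by exact_mod_cast h.symm
      omega
    have hc0 : numCommon b (dummy b φ) = 0 := by omega
    rw [← h, hc0]
    simp [hT0]
  · rw [lt_div_iff₀ h]

lemma integral_prod_bernoulli (p f : unitInterval) (g : Bool × Bool → ℝ) :
    ∫ x, g x ∂((bernoulliMeasure true false p).prod (bernoulliMeasure true false f)) =
      p * (f * g (true, true) + (1 - f) * g (true, false)) +
        (1 - p) * (f * g (false, true) + (1 - f) * g (false, false)) := by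
  rw [integral_prod _ Integrable.of_finite]
  simp [integral_bernoulliMeasure]

lemma integral_excess (p f : unitInterval) (T : ℝ) :
    ∫ x, excess T x ∂((bernoulliMeasure true false p).prod (bernoulliMeasure true false f)) =
      2 * (1 - T) * (1 - f) * p - T * f := by
  rw [integral_prod_bernoulli]
  simp [excess]
  ring

lemma variance_excess_pos {p f : unitInterval} (hp0 : 0 < (p : ℝ)) (hp1 : (p : ℝ) < 1) {T : ℝ}
    (hT1 : T < 1) (hf : (f : ℝ) < 1) :
    0 < variance (excess T)
      ((bernoulliMeasure true false p).prod (bernoulliMeasure true false f)) := by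
  rw [variance_eq_integral (measurable_of_finite _).aemeasurable]
  set m := ∫ x, excess T x ∂((bernoulliMeasure true false p).prod (bernoulliMeasure true false f))
  rw [integral_prod_bernoulli p f fun x => (excess T x - m) ^ 2]
  have hp : 0 < 1 - (p : ℝ) := by linarith
  have h1 : 0 < 1 - (f : ℝ) := by linarith
  have hf0 : 0 ≤ (f : ℝ) := f.2.1
  -- Unflipped bits occur with positive probability for either bit value, and there `excess` is `2
  -- (1 - T) > 0` or `0`; the mean cannot equal both.
  rcases eq_or_ne m 0 with hm | hm
  · have : 0 < (excess T (true, false) - m) ^ 2 := by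
      have : 0 < excess T (true, false) - m := by
        simp [excess, hm]
        linarith
      positivity
    positivity
  · have : 0 < (excess T (false, false) - m) ^ 2 := by
      have : excess T (false, false) - m ≠ 0 := by simpa [excess] using hm
      positivity
    positivity

lemma probFPFlips_eq_pi {n : ℕ} (p f : unitInterval) {T : ℝ} (hT0 : 0 ≤ T) :
    probFPFlips n p T f =
      (Measure.pi fun _ : Fin n =>
        (bernoulliMeasure true false p).prod (bernoulliMeasure true false f)).real
        {a | 0 < ∑ i, excess T (a i)} := by
  have h := measurePreserving_arrowProdEquivProdArrow Bool Bool (Fin n)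
    (fun _ => bernoulliMeasure true false p) (fun _ => bernoulliMeasure true false f)
  rw [probFPFlips, bitsLaw, bitsLaw, ← h.map_eq,
    map_measureReal_apply h.measurable (Set.Finite.measurableSet (Set.toFinite _))]
  congr 1
  ext a
  exact lt_dice_dummy_iff hT0 _ _

/-- Along `√n · y`, the normal tail does not depend on a positive scale in the limit. -/
lemma tendsto_gaussianTail_sub {s t : ℝ} (hs : 0 < s) (ht : 0 < t) (y : ℝ) :
    Tendsto (fun n : ℕ => gaussianTail (√n * (s * y)) - gaussianTail (√n * (t * y)))
      atTop (𝓝 0) := by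
  have hsq : Tendsto (fun n : ℕ => √(n : ℝ)) atTop atTop :=
    Real.tendsto_sqrt_atTop.comp tendsto_natCast_atTop_atTop
  rcases lt_trichotomy y 0 with hy | rfl | hy
  · have h : ∀ r : ℝ, 0 < r → Tendsto (fun n : ℕ => gaussianTail (√n * (r * y))) atTop (𝓝 1) :=
      fun r hr => tendsto_gaussianTail_atBot.comp
        (hsq.atTop_mul_const_of_neg (mul_neg_of_pos_of_neg hr hy))
    simpa using (h s hs).sub (h t ht)
  · simp
  · have h : ∀ r : ℝ, 0 < r → Tendsto (fun n : ℕ => gaussianTail (√n * (r * y))) atTop (𝓝 0) :=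
      fun r hr => tendsto_gaussianTail_atTop.comp (hsq.atTop_mul_const (mul_pos hr hy))
    simpa using (h s hs).sub (h t ht)

theorem tendsto_probFPFlips_sub_approxFP (p : unitInterval) (hp0 : 0 < (p : ℝ))
    (hp1 : (p : ℝ) < 1) {T : ℝ} {f : unitInterval} (hT0 : 0 ≤ T) (hT1 : T < 1)
    (hf : (f : ℝ) < 1) :
    Tendsto (fun n : ℕ => probFPFlips n p T f - approxFP n T f p √(p * (1 - p)))
      atTop (𝓝 0) := by
  have hσ : 0 < √((p : ℝ) * (1 - p)) := Real.sqrt_pos.2 (mul_pos hp0 (by linarith))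
  have hv := variance_excess_pos hp0 hp1 hT1 hf
  set v := variance (excess T)
    ((bernoulliMeasure true false p).prod (bernoulliMeasure true false f))
  set m : ℝ := 2 * (1 - T) * (1 - f) * p - T * f with hm
  have hT : 0 < 1 - T := by linarith
  have h1 : 0 < 1 - (f : ℝ) := by linarith
  have hclt : Tendsto (fun n : ℕ => probFPFlips n p T f -
      gaussianTail (√n * ((√v)⁻¹ * -m))) atTop (𝓝 0) := by
    rw [Metric.tendsto_nhds]
    intro ε hε
    filter_upwards [pi_sum_tail_approx
      ((bernoulliMeasure true false p).prod (bernoulliMeasure true false f))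
      (measurable_of_finite (excess T)) MemLp.of_discrete (integral_excess p f T)
      (Real.sqrt_pos.2 hv) (Real.sq_sqrt hv.le).symm hε] with n hn
    rw [Real.dist_0_eq_abs, probFPFlips_eq_pi p f hT0]
    convert hn 0 using 4
    rw [zero_sub, ← mul_neg, sqrt_standardize _ _ (Real.sqrt_pos.2 hv), div_eq_mul_inv]
    ring
  -- This `t` is the scale for which `t * -m` is the argument of the tail in
  -- `approxFP_eq_gaussianTail`, up to the factor `√n`.
  have hsum := hclt.add (tendsto_gaussianTail_sub (inv_pos.2 (Real.sqrt_pos.2 hv))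
    (t := (2 * (1 - T) * (1 - f) * √((p : ℝ) * (1 - p)))⁻¹) (by positivity) (-m))
  rw [add_zero] at hsum
  refine hsum.congr fun n => ?_
  rw [sub_add_sub_cancel, approxFP_eq_gaussianTail]
  congr 2
  rw [hm]
  field_simp
  ring

end BloomLinkage

open BloomLinkage in
theorem theorem4
    {Ω : Type*} [MeasurableSpace Ω] (P : Measure Ω) [IsProbabilityMeasure P]
    (X : ℕ → Ω → ℝ) (μ σ : ℝ)
    (hindep : iIndepFun X P) (hident : ∀ i, IdentDistrib (X i) (X 0) P P)
    (hX : MemLp (X 0) 2 P) (hμ : ∫ ω, X 0 ω ∂P = μ)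
    (hσ : 0 < σ) (hVar : variance (X 0) P = σ ^ 2)
    (p : unitInterval) (hp0 : 0 < (p : ℝ)) (hp1 : (p : ℝ) < 1) :
    -- the central limit theorem
    TendstoInDistribution
      (fun (n : ℕ) ω => ((∑ i ∈ range n, X i ω) - n * μ) / √(n * σ ^ 2)) atTop
      (fun x : ℝ => x) (fun _ => P) (gaussianReal 0 1) ∧
    -- the bits of the progenitor are i.i.d. with mean `p` and variance `p (1 - p)`,
    -- and the number of set bits is binomial
    (∀ n : ℕ,
      iIndepFun (fun (i : Fin n) (b : BloomFilter n) => bitVal (b i)) (bitsLaw n p) ∧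
      (∀ i : Fin n, ∫ b, bitVal (b i) ∂(bitsLaw n p) = p ∧
        variance (fun b : BloomFilter n => bitVal (b i)) (bitsLaw n p) = p * (1 - p)) ∧
      (bitsLaw n p).map numOnes = ProbabilityTheory.binomial n p) ∧
    -- the Dice coefficient of a dummy record and its progenitor
    (∀ (n : ℕ) (f : unitInterval) (b : BloomFilter n),
      expCommon f b = (1 - f) * numOnes b ∧
      expOnes f b = (1 - f) * numOnes b + f * (n - numOnes b) ∧
      diceDum f b = 2 * (1 - f) * numOnes b /
        (numOnes b + (1 - f) * numOnes b + f * (n - numOnes b)) ∧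
      ((f : ℝ) < 1 → 0 < numOnes b →
        diceDum f b = ((f : ℝ) * n / (2 * (1 - f) * numOnes b) + 1)⁻¹)) ∧
    -- the characterization of a false match by the number of set bits, and its probability
    (∀ (n : ℕ) (T : ℝ) (f : unitInterval), 0 ≤ T → T < 1 → (f : ℝ) < 1 →
      (∀ b : BloomFilter n, T < diceDum f b ↔ onesThreshold n T f < numOnes b) ∧
      probFP n p T f = ∑ k ∈ range (n + 1) with onesThreshold n T f < ((k : ℕ) : ℝ),
        (n.choose k : ℝ) * (p : ℝ) ^ k * (1 - p) ^ (n - k)) ∧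
    -- the normal approximation, uniform in the threshold and in the flipping probability
    (∀ ε : ℝ, 0 < ε → ∃ N : ℕ, ∀ n : ℕ, N ≤ n →
      ∀ (T : ℝ) (f : unitInterval), 0 ≤ T → T < 1 → (f : ℝ) < 1 →
        |probFP n p T f - approxFP n T f p √(p * (1 - p))| < ε) ∧
    -- the same approximation when the Dice coefficient is that of the randomly flipped filter
    (∀ (T : ℝ) (f : unitInterval), 0 ≤ T → T < 1 → (f : ℝ) < 1 →
      Tendsto (fun n : ℕ => probFPFlips n p T f - approxFP n T f p √(p * (1 - p)))
        atTop (𝓝 0)) := by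
  refine ⟨tendstoInDistribution_standardized_sum hindep hident hX hμ hσ hVar,
    fun n => ⟨iIndepFun_bitVal n p, fun i => ⟨?_, variance_bit p i⟩, map_numOnes_bitsLaw n p⟩,
    fun n f b => ⟨expCommon_eq f b, expOnes_eq f b, diceDum_eq f b, diceDum_eq_inv⟩,
    fun n T f hT0 hT1 hf => ⟨lt_diceDum_iff hT0 hT1 hf, ?_⟩,
    fun ε hε => probFP_approx p hp0 hp1 hε,
    fun T f hT0 hT1 hf => tendsto_probFPFlips_sub_approxFP p hp0 hp1 hT0 hT1 hf⟩
  · simp [integral_bit p i bitVal]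
  · rw [probFP_eq_real_numOnes p hT0 hT1 hf, bitsLaw_real_lt_numOnes]
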